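/- Let $N\ge 1$, $1\le p<\infty$, and let $K\subset\mathbf R^N$ be compact. For an open set $\Omega\subset\mathbf R^N$ let $W^{1,p}(\Omega,\mathbf R^N)$ be the set of functions $u:\mathbf R^N\to\mathbf R$ whose restriction to $\Omega$ belongs to $W^{1,p}(\Omega)$, i.e. $u$ and all its first order weak partial derivatives on $\Omega$ are in $L^p(\Omega)$. For compact $F\subset\mathbf R^N$ put $$C_{1,p}(F)=\inf\Big\{\sum_{|\alpha|\le 1}\|D^\alpha\varphi\|_{L^p(\mathbf R^N)}:\ \varphi\in C_0^\infty(\mathbf R^N),\ \varphi\ge 1\text{ on }F\Big\},$$ and for open $\omega\subset\mathbf R^N$ put $C_{1,p}(\omega)=\sup\{C_{1,p}(F): F\subset\omega\text{ compact}\}$. Let $Q$ be the set of measurable functions $u:\mathbf R^N\to\mathbf R$ that are quasicontinuous: for every $\varepsilon>0$ there is an open set $\omega$ with $C_{1,p}(\omega)<\varepsilon$ such that the restriction of $u$ to $\mathbf R^N\setminus\omega$ is continuous. Say that $K$ has the $J_p$-property if $$Q\cap W^{1,p}(\mathbf R^N\setminus K,\mathbf R^N)=Q\cap W^{1,p}(\mathbf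 R^N),$$ and the $J_p(\mathrm{cont})$-property if the same holds with $Q$ replaced by $C(\mathbf R^N)$. **Corollary 1.9.** Suppose that there are $N$ linearly independent directions $v_1,\dots,v_N\in\mathbf R^N$ such that, for each $i$, almost every line parallel to $v_i$ meets $K$ in an at most countable set; that is, the set of those $y$ in the hyperplane $v_i^\perp$ for which $K\cap(y+\mathbf R v_i)$ is uncountable has $(N-1)$-dimensional Lebesgue measure zero. Then $K$ has the $J_p$-property, and also the $J_p(\mathrm{cont})$-property. -/

import Mathlib

open MeasureTheory
open scoped ENNReal

noncomputable section

namespace SobolevRemovability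

variable {N : ℕ}

/-- The classical `i`-th partial derivative of a (differentiable) function on `ℝ^N`. -/
def partialDeriv (i : Fin N) (φ : EuclideanSpace ℝ (Fin N) → ℝ)
    (x : EuclideanSpace ℝ (Fin N)) : ℝ :=
  fderiv ℝ φ x (EuclideanSpace.single i 1)

/-- `φ` belongs to `C₀^∞(Ω)`: it is smooth, with compact support contained in `Ω`. -/
def IsTestFunction (Ω : Set (EuclideanSpace ℝ (Fin N)))
    (φ : EuclideanSpace ℝ (Fin N) → ℝ) : Prop :=
  ContDiff ℝ (⊤ : ℕ∞) φ ∧ HasCompactSupport φ ∧ tsupport φ ⊆ Ω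

/-- `g` is the `i`-th weak partial derivative of `u` on `Ω`
(used below only for `u` and `g` in `L^p(Ω)` with `p ≥ 1`, so that the integrals converge). -/
def IsWeakPartialDeriv (Ω : Set (EuclideanSpace ℝ (Fin N))) (i : Fin N)
    (u g : EuclideanSpace ℝ (Fin N) → ℝ) : Prop :=
  ∀ φ : EuclideanSpace ℝ (Fin N) → ℝ, IsTestFunction Ω φ →
    ∫ x in Ω, u x * partialDeriv i φ x = -∫ x in Ω, g x * φ x

/-- The set of functions `u : ℝ^N → ℝ` whose restriction to the open set `Ω` belongs to
`W^{1,p}(Ω)`: `u` and all its first order weak derivatives on `Ω` are in `L^p(Ω)`. -/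
def W1p (p : ℝ≥0∞) (Ω : Set (EuclideanSpace ℝ (Fin N))) :
    Set (EuclideanSpace ℝ (Fin N) → ℝ) :=
  {u | MemLp u p (volume.restrict Ω) ∧
    ∀ i : Fin N, ∃ g : EuclideanSpace ℝ (Fin N) → ℝ,
      MemLp g p (volume.restrict Ω) ∧ IsWeakPartialDeriv Ω i u g}

/-- The first order Sobolev norm `∑_{|α| ≤ 1} ‖D^α φ‖_{L^p(ℝ^N)}` of a smooth function. -/
def sobolevNorm (p : ℝ≥0∞) (φ : EuclideanSpace ℝ (Fin N) → ℝ) : ℝ≥0∞ :=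
  eLpNorm φ p volume + ∑ i : Fin N, eLpNorm (partialDeriv i φ) p volume

/-- The capacity `C_{1,p}` of a compact set. -/
def capCompact (p : ℝ≥0∞) (K : Set (EuclideanSpace ℝ (Fin N))) : ℝ≥0∞ :=
  sInf {c | ∃ φ : EuclideanSpace ℝ (Fin N) → ℝ,
    IsTestFunction Set.univ φ ∧ (∀ x ∈ K, 1 ≤ φ x) ∧ c = sobolevNorm p φ}

/-- The capacity `C_{1,p}` of an open set. -/
def capOpen (p : ℝ≥0∞) (ω : Set (EuclideanSpace ℝ (Fin N))) : ℝ≥0∞ :=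
  sSup {c | ∃ K : Set (EuclideanSpace ℝ (Fin N)), IsCompact K ∧ K ⊆ ω ∧ c = capCompact p K}

/-- The set `Q` of (Lebesgue) measurable functions on `ℝ^N` that are quasicontinuous with
respect to `C_{1,p}`: off open sets of arbitrarily small capacity, the restriction of the function
is continuous. -/
def quasiContinuous (p : ℝ≥0∞) : Set (EuclideanSpace ℝ (Fin N) → ℝ) :=
  {u | AEMeasurable u volume ∧
    ∀ ε : ℝ≥0∞, 0 < ε → ∃ ω : Set (EuclideanSpace ℝ (Fin N)),
      IsOpen ω ∧ capOpen p ω < ε ∧ ContinuousOn u ωᶜ}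

/-- The (quasicontinuous) `J_p`-property:
every quasicontinuous function that is in `W^{1,p}` off `K` is in `W^{1,p}(ℝ^N)`. -/
def JProperty (p : ℝ≥0∞) (K : Set (EuclideanSpace ℝ (Fin N))) : Prop :=
  quasiContinuous p ∩ W1p p Kᶜ = quasiContinuous p ∩ W1p p Set.univ

/-- The continuous `J_p`-property, `J_p(cont)`. -/
def JPropertyCont (p : ℝ≥0∞) (K : Set (EuclideanSpace ℝ (Fin N))) : Prop :=
  {u | Continuous u} ∩ W1p p Kᶜ = {u | Continuous u} ∩ W1p p Set.univ

/-- The line through `y` in the direction `v`. -/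
def line (y v : EuclideanSpace ℝ (Fin N)) : Set (EuclideanSpace ℝ (Fin N)) :=
  {x | ∃ t : ℝ, x = y + t • v}

/-- Almost every line in the direction `v` meets `K` in an at most countable set. The lines in the
direction `v ≠ 0` are parametrized by their intersection with the hyperplane orthogonal to `v`,
which carries its `(N-1)`-dimensional Lebesgue measure. -/
def AELineMeetsCountably (K : Set (EuclideanSpace ℝ (Fin N)))
    (v : EuclideanSpace ℝ (Fin N)) : Prop :=
  ∀ᵐ y : (Submodule.span ℝ {v})ᗮ ∂volume,
    (K ∩ line (y : EuclideanSpace ℝ (Fin N)) v).Countable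

end SobolevRemovability

end

open Filter Topology

namespace SobolevRemovability

/-! Countable slices are null, so by Fubini `K` has measure zero. The weak derivatives of `u` off
`K` are therefore already `L^p` functions on the whole space. What remains is to integrate by parts
against test functions that do not vanish near `K`.

This is done line by line in each direction `v i`. A set of small capacity has a bounded part whose
projection along `v i` has small measure, so a quasicontinuous `u` is continuous on almost every
line (`ae_continuous_slice_of_quasiContinuous`). On almost every line, `u` minus the primitive of
its directional derivative is continuous, and locally constant off a countable closed set, hence
constant (`eq_add_primitive_of_cutoff_test`). So `u` is locally absolutely continuous there,
integration by parts holds on the line, and Fubini gives it on the space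
(`weak_deriv_of_countable_slices`). Both sides of the identity are linear in the direction and the
`v i` span, so the coordinate derivatives follow. -/

/-! ### Calculus on one line -/

/-- The primitive is absolutely continuous on bounded intervals, with derivative `g` almost
everywhere by Lebesgue differentiation. Integrate by parts on an interval whose interior contains
the support of `ψ`. -/
theorem integral_const_add_primitive_mul_deriv {g ψ : ℝ → ℝ} (hg : LocallyIntegrable g volume)
    (hψ : ContDiff ℝ 1 ψ) (hs : HasCompactSupport ψ) (C : ℝ) :
    ∫ t, (C + ∫ s in (0 : ℝ)..t, g s) * deriv ψ t = -∫ t, g t * ψ t := by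
  obtain ⟨R, hR0, hR⟩ : ∃ R : ℝ, 0 < R ∧ tsupport ψ ⊆ Set.Ioo (-R) R := by
    obtain ⟨R, hR⟩ := hs.isCompact.isBounded.subset_ball 0
    refine ⟨max R 1, by positivity, fun x hx => ?_⟩
    have := hR hx
    rw [Real.ball_zero_eq_Ioo] at this
    have := le_max_left R 1
    constructor <;> linarith [this, ‹x ∈ Set.Ioo (-R) R›.1, ‹x ∈ Set.Ioo (-R) R›.2]
  have hloc : ∀ a b, IntervalIntegrable g volume a b := fun a b =>
    (hg.integrableOn_isCompact isCompact_uIcc).intervalIntegrable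
  have hAC : AbsolutelyContinuousOnInterval (fun t => C + ∫ s in (0 : ℝ)..t, g s) (-R) R := by
    refine AbsolutelyContinuousOnInterval.add ?_ ?_
    · exact (contDiff_const (n := 1)).contDiffOn.absolutelyContinuousOnInterval
    · exact (hloc (-R) R).absolutelyContinuousOnInterval_intervalIntegral
        (by rw [Set.uIcc_of_le (by linarith)]; constructor <;> linarith)
  have hψAC : AbsolutelyContinuousOnInterval ψ (-R) R :=
    hψ.contDiffOn.absolutelyContinuousOnInterval
  have key := hAC.integral_mul_deriv_eq_deriv_mul hψAC
  have hz : ∀ t ∉ Set.Ioo (-R) R, ψ t = 0 := fun t ht =>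
    image_eq_zero_of_notMem_tsupport fun h => ht (hR h)
  have hz' : ∀ t ∉ Set.Ioo (-R) R, deriv ψ t = 0 := fun t ht =>
    image_eq_zero_of_notMem_tsupport fun h => ht (hR (tsupport_deriv_subset h))
  rw [hz R (by simp), hz (-R) (by simp), mul_zero, mul_zero, sub_zero, zero_sub] at key
  have hae : ∀ᵐ t, deriv (fun t => C + ∫ s in (0 : ℝ)..t, g s) t * ψ t = g t * ψ t := by
    filter_upwards [LocallyIntegrable.ae_hasDerivAt_integral hg] with t ht
    rw [((ht 0).const_add C).deriv]
  rw [intervalIntegral.integral_congr_ae (g := fun t => g t * ψ t)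
    (hae.mono fun t ht _ => ht), intervalIntegral.integral_of_le (by linarith),
    intervalIntegral.integral_of_le (by linarith), ← integral_Icc_eq_integral_Ioc,
    ← integral_Icc_eq_integral_Ioc,
    setIntegral_eq_integral_of_forall_compl_eq_zero,
    setIntegral_eq_integral_of_forall_compl_eq_zero] at key
  · exact key
  · intro t ht; rw [hz t fun h => ht (Set.Ioo_subset_Icc_self h), mul_zero]
  · intro t ht; rw [hz' t fun h => ht (Set.Ioo_subset_Icc_self h), mul_zero]

/-- A smooth function equal to `1` on `[a + r, b]` and supported in `[a, b + r]`. -/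
noncomputable def cutoff (a b r t : ℝ) : ℝ :=
  Real.smoothTransition ((t - a) / r) - Real.smoothTransition ((t - b) / r)

theorem contDiff_cutoff (a b r : ℝ) {n : ℕ∞} : ContDiff ℝ n (cutoff a b r) := by
  unfold cutoff
  exact (Real.smoothTransition.contDiff.comp ((contDiff_id.sub contDiff_const).div_const _)).sub
    (Real.smoothTransition.contDiff.comp ((contDiff_id.sub contDiff_const).div_const _))

theorem tsupport_cutoff_subset {a b r : ℝ} (hab : a ≤ b) (hr : 0 < r) :
    tsupport (cutoff a b r) ⊆ Set.Icc a (b + r) := by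
  refine closure_minimal (fun t ht => ?_) isClosed_Icc
  by_contra hcon
  apply ht
  rw [Set.mem_Icc, not_and_or, not_le, not_le] at hcon
  rcases hcon with h | h
  · simp only [cutoff]
    rw [Real.smoothTransition.zero_of_nonpos, Real.smoothTransition.zero_of_nonpos, sub_zero]
    · exact div_nonpos_of_nonpos_of_nonneg (by linarith) hr.le
    · exact div_nonpos_of_nonpos_of_nonneg (by linarith) hr.le
  · simp only [cutoff]
    rw [Real.smoothTransition.one_of_one_le, Real.smoothTransition.one_of_one_le, sub_self]
    · rw [le_div_iff₀ hr]; linarith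
    · rw [le_div_iff₀ hr]; linarith

theorem hasCompactSupport_cutoff {a b r : ℝ} (hab : a ≤ b) (hr : 0 < r) :
    HasCompactSupport (cutoff a b r) :=
  isCompact_Icc.of_isClosed_subset (isClosed_tsupport _) (tsupport_cutoff_subset hab hr)

theorem differentiable_smoothTransition : Differentiable ℝ Real.smoothTransition :=
  (Real.smoothTransition.contDiff (n := 1)).differentiable (by simp)

theorem continuous_deriv_smoothTransition : Continuous (deriv Real.smoothTransition) :=
  (Real.smoothTransition.contDiff (n := 1)).continuous_deriv (by simp)

theorem deriv_smoothTransition_eq_zero {t : ℝ} (ht : t ∉ Set.Icc (0 : ℝ) 1) :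
    deriv Real.smoothTransition t = 0 := by
  rw [Set.mem_Icc, not_and_or, not_le, not_le] at ht
  rcases ht with h | h
  · have : Real.smoothTransition =ᶠ[𝓝 t] fun _ => 0 := by
      filter_upwards [Iio_mem_nhds h] with s hs
      exact Real.smoothTransition.zero_of_nonpos (le_of_lt hs)
    rw [this.deriv_eq, deriv_const]
  · have : Real.smoothTransition =ᶠ[𝓝 t] fun _ => 1 := by
      filter_upwards [Ioi_mem_nhds h] with s hs
      exact Real.smoothTransition.one_of_one_le (le_of_lt hs)
    rw [this.deriv_eq, deriv_const]

theorem deriv_cutoff (a b r t : ℝ) : deriv (cutoff a b r) t =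
    deriv Real.smoothTransition ((t - a) / r) * r⁻¹ -
      deriv Real.smoothTransition ((t - b) / r) * r⁻¹ := by
  have h : ∀ c : ℝ, HasDerivAt (fun t => Real.smoothTransition ((t - c) / r))
      (deriv Real.smoothTransition ((t - c) / r) * r⁻¹) t := fun c => by
    have := (differentiable_smoothTransition ((t - c) / r)).hasDerivAt.comp t
      (((hasDerivAt_id t).sub_const c).div_const r)
    simpa [one_div, Function.comp_def] using this
  exact ((h a).sub (h b)).deriv

/-- The substitution `t = a + r * s` moves `r` from the kernel into the argument of `F`, so that for
continuous `F` the right-hand side is continuous in `r` even at `r = 0`. -/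
theorem integral_mul_deriv_smoothTransition_scaled (F : ℝ → ℝ) (a : ℝ) {r : ℝ} (hr : 0 < r) :
    ∫ t, F t * (deriv Real.smoothTransition ((t - a) / r) * r⁻¹) =
      ∫ s in (0 : ℝ)..1, F (a + r * s) * deriv Real.smoothTransition s := by
  have h1 : ∀ t, F t * (deriv Real.smoothTransition ((t - a) / r) * r⁻¹) =
      (fun s => r⁻¹ * (F (a + r * s) * deriv Real.smoothTransition s)) (r⁻¹ * (t - a)) := by
    intro t
    have : a + r * (r⁻¹ * (t - a)) = t := by field_simp; ring
    simp only [this]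
    rw [div_eq_inv_mul]; ring
  simp_rw [h1]
  rw [integral_sub_right_eq_self
    (fun x => (fun s => r⁻¹ * (F (a + r * s) * deriv Real.smoothTransition s)) (r⁻¹ * x)) a,
    Measure.integral_comp_mul_left
      (fun s => r⁻¹ * (F (a + r * s) * deriv Real.smoothTransition s)), integral_const_mul,
    intervalIntegral.integral_of_le zero_le_one, ← integral_Icc_eq_integral_Ioc,
    setIntegral_eq_integral_of_forall_compl_eq_zero]
  · rw [inv_inv, abs_of_pos hr, smul_eq_mul, ← mul_assoc, mul_inv_cancel₀ hr.ne', one_mul]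
  · intro t ht; rw [deriv_smoothTransition_eq_zero ht, mul_zero]

theorem integrable_mul_deriv_smoothTransition_scaled {F : ℝ → ℝ} (hF : Continuous F) (a : ℝ)
    {r : ℝ} (hr : 0 < r) :
    Integrable fun t => F t * (deriv Real.smoothTransition ((t - a) / r) * r⁻¹) := by
  apply Continuous.integrable_of_hasCompactSupport
  · exact hF.mul ((continuous_deriv_smoothTransition.comp (by fun_prop)).mul continuous_const)
  · refine HasCompactSupport.intro (isCompact_Icc (a := a) (b := a + r)) fun t ht => ?_
    rw [deriv_smoothTransition_eq_zero, zero_mul, mul_zero]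
    contrapose! ht
    rw [Set.mem_Icc, le_div_iff₀ hr, div_le_iff₀ hr] at ht
    constructor <;> linarith [ht.1, ht.2]

/-- The derivative of the cutoff is a difference of two kernels of mass one, concentrating at `a`
and at `b`. -/
theorem tendsto_integral_mul_deriv_cutoff {F : ℝ → ℝ} (hF : Continuous F) (a b : ℝ) :
    Tendsto (fun r => ∫ t, F t * deriv (cutoff a b r) t) (𝓝[>] 0) (𝓝 (F a - F b)) := by
  have hlim : ∀ c, Tendsto (fun r : ℝ => ∫ s in (0 : ℝ)..1, F (c + r * s) *
      deriv Real.smoothTransition s) (𝓝[>] 0) (𝓝 (F c)) := by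
    intro c
    have hc : Continuous fun r : ℝ => ∫ s in (0 : ℝ)..1, F (c + r * s) *
        deriv Real.smoothTransition s := by
      apply intervalIntegral.continuous_parametric_intervalIntegral_of_continuous'
      exact (hF.comp (by fun_prop)).mul (continuous_deriv_smoothTransition.comp continuous_snd)
    have h0 := (hc.tendsto 0).mono_left (nhdsWithin_le_nhds (s := Set.Ioi 0))
    simp only [zero_mul, add_zero, intervalIntegral.integral_const_mul] at h0
    rwa [intervalIntegral.integral_deriv_eq_sub
      (fun x _ => differentiable_smoothTransition x)
      (continuous_deriv_smoothTransition.intervalIntegrable _ _), Real.smoothTransition.one,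
      Real.smoothTransition.zero, sub_zero, mul_one] at h0
  refine ((hlim a).sub (hlim b)).congr' ?_
  filter_upwards [self_mem_nhdsWithin] with r hr
  rw [← integral_mul_deriv_smoothTransition_scaled F a hr,
    ← integral_mul_deriv_smoothTransition_scaled F b hr, ← integral_sub
    (integrable_mul_deriv_smoothTransition_scaled hF a hr)
    (integrable_mul_deriv_smoothTransition_scaled hF b hr)]
  simp_rw [deriv_cutoff, mul_sub]

/-- A continuous function that is locally constant off a countable set is constant. -/
theorem eq_of_locally_constant_off_countable {F : ℝ → ℝ} (hF : Continuous F) {E : Set ℝ}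
    (hE : E.Countable) (h : ∀ t ∉ E, ∀ᶠ s in 𝓝 t, F s = F t) (a b : ℝ) : F b = F a := by
  have := integral_eq_of_hasDerivAt_off_countable F (fun _ => 0) hE hF.continuousOn
    (a := a) (b := b) (fun x hx => ((hasDerivAt_const x (F x)).congr_of_eventuallyEq (h x hx.2)))
    (by simp)
  simp only [intervalIntegral.integral_zero] at this
  linarith

/-- Testing against cutoffs shows, as their width tends to zero, that `U` minus the primitive of `g`
agrees at `a` and `b`. Only countably many cutoffs are used, since in the application each one costs
a null set of lines. The test is required only for large `n`, because the support reaches beyond `b`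
by `1 / (n + 1)`. -/
theorem eq_add_primitive_of_cutoff_test {U g : ℝ → ℝ} (hU : Continuous U)
    (hg : LocallyIntegrable g volume) {E : Set ℝ} (hE : IsClosed E) (hEc : E.Countable)
    (htest : ∀ a b : ℚ, a < b → Set.Icc (a : ℝ) b ⊆ Eᶜ → ∀ᶠ n : ℕ in atTop,
      ∫ t, (U t * deriv (cutoff a b (1 / ((n : ℝ) + 1))) t +
        g t * cutoff a b (1 / ((n : ℝ) + 1)) t) = 0) (t : ℝ) :
    U t = U 0 + ∫ s in (0 : ℝ)..t, g s := by
  set H : ℝ → ℝ := fun t => ∫ s in (0 : ℝ)..t, g s with hH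
  have hHc : Continuous H :=
    intervalIntegral.continuous_primitive (fun a b =>
    (hg.integrableOn_isCompact isCompact_uIcc).intervalIntegrable) 0
  have hFc : Continuous fun t => U t - H t := hU.sub hHc
  have hrat : ∀ a b : ℚ, a < b → Set.Icc (a : ℝ) b ⊆ Eᶜ → U a - H a = U b - H b := by
    intro a b hab hsub
    have hab' : (a : ℝ) ≤ b := by exact_mod_cast hab.le
    have hseq : Tendsto (fun n : ℕ => 1 / ((n : ℝ) + 1)) atTop (𝓝[>] 0) :=
      tendsto_nhdsWithin_iff.2 ⟨tendsto_one_div_add_atTop_nhds_zero_nat,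
        Eventually.of_forall fun n => Set.mem_Ioi.2 (by positivity)⟩
    have hlim := (tendsto_integral_mul_deriv_cutoff hFc a b).comp hseq
    have hzero : ∀ᶠ n : ℕ in atTop, ((fun r => ∫ t, (U t - H t) * deriv (cutoff a b r) t) ∘
        fun n : ℕ => 1 / ((n : ℝ) + 1)) n = 0 := by
      filter_upwards [htest a b hab hsub] with n hn
      have hr : (0 : ℝ) < 1 / ((n : ℝ) + 1) := by positivity
      set r : ℝ := 1 / ((n : ℝ) + 1)
      have hcs := hasCompactSupport_cutoff hab' hr
      have hcd : Continuous (deriv (cutoff a b r)) :=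
        (contDiff_cutoff a b r (n := 1)).continuous_deriv (by simp)
      have i1 : Integrable fun t => U t * deriv (cutoff a b r) t :=
        (hU.mul hcd).integrable_of_hasCompactSupport hcs.deriv.mul_left
      have i2 : Integrable fun t => H t * deriv (cutoff a b r) t :=
        (hHc.mul hcd).integrable_of_hasCompactSupport hcs.deriv.mul_left
      have i3 : Integrable fun t => g t * cutoff a b r t :=
        hg.integrable_smul_right_of_hasCompactSupport
          (contDiff_cutoff a b r (n := 1)).continuous hcs
      have hP := integral_const_add_primitive_mul_deriv hg
        (contDiff_cutoff a b r (n := 1)) hcs 0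
      simp only [zero_add] at hP
      rw [integral_add i1 i3] at hn
      simp only [Function.comp_def, sub_mul]
      rw [integral_sub i1 i2, hP]
      linarith
    have := tendsto_nhds_unique hlim ((tendsto_congr' hzero).2 tendsto_const_nhds)
    linarith
  have hloc : ∀ t ∉ E, ∀ᶠ s in 𝓝 t, U s - H s = U t - H t := by
    intro t ht
    obtain ⟨δ, hδ, hball⟩ := Metric.isOpen_iff.1 hE.isOpen_compl t ht
    rw [Real.ball_eq_Ioo] at hball
    obtain ⟨q, hq1, hq2⟩ := exists_rat_btwn (show t - δ < t by linarith)
    -- Equality with the value at the rational point `q` is known at rational points of the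
    -- interval; density and continuity extend it to all points.
    have hconst : Set.Ioo (t - δ) (t + δ) ⊆ {s | U s - H s = U q - H q} := by
      refine (Rat.denseRange_cast (𝕜 := ℝ)).open_subset_closure_inter isOpen_Ioo |>.trans ?_
      refine closure_minimal ?_ (isClosed_eq hFc continuous_const)
      rintro _ ⟨hs, ⟨b, rfl⟩⟩
      rcases lt_trichotomy b q with h | h | h
      · refine hrat b q h (fun x hx => hball ⟨?_, ?_⟩)
        · exact hs.1.trans_le hx.1
        · exact hx.2.trans_lt (by linarith)
      · subst h; rfl
      · refine (hrat q b h (fun x hx => hball ⟨?_, ?_⟩)).symm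
        · exact hq1.trans_le hx.1
        · exact hx.2.trans_lt hs.2
    filter_upwards [Ioo_mem_nhds (show t - δ < t by linarith) (show t < t + δ by linarith)]
      with s hs
    exact (hconst hs).trans (hconst ⟨by linarith, by linarith⟩ : U t - H t = U q - H q).symm
  have h0 := eq_of_locally_constant_off_countable hFc hEc hloc 0 t
  have h00 : H 0 = 0 := by simp [hH]
  change U t = U 0 + H t
  linarith

/-! ### Weak derivatives on a product and their slices -/

theorem deriv_slice {Y : Type*} [NormedAddCommGroup Y] [NormedSpace ℝ Y] {φ : Y × ℝ → ℝ}
    (hφ : Differentiable ℝ φ) (y : Y) (t : ℝ) :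
    deriv (fun s => φ (y, s)) t = fderiv ℝ φ (y, t) (0, 1) := by
  have h : HasDerivAt (fun s : ℝ => (y, s)) ((0 : Y), (1 : ℝ)) t :=
    (hasDerivAt_const t y).prodMk (hasDerivAt_id t)
  exact ((hφ (y, t)).hasFDerivAt.comp_hasDerivAt t h).deriv

section Product

variable {Y : Type*} [NormedAddCommGroup Y] [NormedSpace ℝ Y] [FiniteDimensional ℝ Y]
  [MeasurableSpace Y] [BorelSpace Y] {μ : Measure Y} [SFinite μ]

theorem ae_locallyIntegrable_slice {G : Y × ℝ → ℝ} (hG : LocallyIntegrable G (μ.prod volume)) :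
    ∀ᵐ y ∂μ, LocallyIntegrable (fun t => G (y, t)) volume := by
  have : ProperSpace Y := FiniteDimensional.proper_real Y
  have hn : ∀ n : ℕ, ∀ᵐ y ∂μ, y ∈ Metric.closedBall (0 : Y) n →
      IntegrableOn (fun t => G (y, t)) (Metric.closedBall (0 : ℝ) n) volume := by
    intro n
    have h1 : IntegrableOn G (Metric.closedBall (0 : Y) n ×ˢ Metric.closedBall (0 : ℝ) n)
        (μ.prod volume) := hG.integrableOn_isCompact
      ((isCompact_closedBall _ _).prod (isCompact_closedBall _ _))
    rw [IntegrableOn, ← Measure.prod_restrict] at h1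
    exact (ae_restrict_iff' Metric.isClosed_closedBall.measurableSet).1 h1.prod_right_ae
  filter_upwards [ae_all_iff.2 hn] with y hy x
  obtain ⟨n, hn⟩ := exists_nat_gt (max ‖y‖ ‖x‖)
  refine ⟨Metric.closedBall (0 : ℝ) n, Metric.closedBall_mem_nhds_of_mem ?_, hy n ?_⟩
  · rw [mem_ball_zero_iff]; exact (le_max_right _ _).trans_lt hn
  · rw [mem_closedBall_zero_iff]; exact ((le_max_left _ _).trans_lt hn).le

/-- Apply the weak identity to products `η y * ψ t`. By Fubini the slice integral, as a function of
`y`, is orthogonal to every smooth `η` with compact support in `B`, hence zero almost everywhere on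
`B`. -/
theorem ae_slice_test {U G : Y × ℝ → ℝ} (hU : LocallyIntegrable U (μ.prod volume))
    (hG : LocallyIntegrable G (μ.prod volume)) {Ω : Set (Y × ℝ)}
    (hweak : ∀ φ : Y × ℝ → ℝ, ContDiff ℝ (⊤ : ℕ∞) φ → HasCompactSupport φ → tsupport φ ⊆ Ω →
      ∫ z, U z * fderiv ℝ φ z (0, 1) ∂(μ.prod volume) = -∫ z, G z * φ z ∂(μ.prod volume))
    {B : Set Y} (hB : IsOpen B) {ψ : ℝ → ℝ} (hψ : ContDiff ℝ (⊤ : ℕ∞) ψ)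
    (hψs : HasCompactSupport ψ) (hBψ : B ×ˢ tsupport ψ ⊆ Ω) :
    ∀ᵐ y ∂μ, y ∈ B → ∫ t, (U (y, t) * deriv ψ t + G (y, t) * ψ t) = 0 := by
  have : ProperSpace Y := FiniteDimensional.proper_real Y
  have hψd : Continuous (deriv ψ) := hψ.continuous_deriv (by simp)
  set V : Y × ℝ → ℝ := fun z => U z * deriv ψ z.2 + G z * ψ z.2 with hV
  have hVint : ∀ C : Set Y, IsCompact C →
      Integrable V ((μ.restrict C).prod volume) := by
    intro C hC
    have hcpt : IsCompact (C ×ˢ tsupport ψ) := hC.prod hψs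
    have h1 : IntegrableOn V (C ×ˢ tsupport ψ) (μ.prod volume) := by
      refine IntegrableOn.add ?_ ?_
      · exact (hU.integrableOn_isCompact hcpt).mul_continuousOn
          (hψd.comp continuous_snd).continuousOn hcpt
      · exact (hG.integrableOn_isCompact hcpt).mul_continuousOn
          (hψ.continuous.comp continuous_snd).continuousOn hcpt
    -- `V` vanishes when `t` is off the support of `ψ`, so integrability on a compact box gives it
    -- on the whole strip.
    have h2 : IntegrableOn V (C ×ˢ Set.univ) (μ.prod volume) := by
      refine h1.of_forall_sdiff_eq_zero (hC.measurableSet.prod MeasurableSet.univ) ?_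
      rintro ⟨y, t⟩ ⟨hz1, hz2⟩
      have ht : t ∉ tsupport ψ := fun h => hz2 ⟨hz1.1, h⟩
      simp only [hV]
      rw [image_eq_zero_of_notMem_tsupport ht,
        image_eq_zero_of_notMem_tsupport fun h => ht (tsupport_deriv_subset h)]
      simp
    rwa [IntegrableOn, ← Measure.prod_restrict, Measure.restrict_univ] at h2
  refine hB.ae_eq_zero_of_integral_contDiff_smul_eq_zero
    (f := fun y => ∫ t, (U (y, t) * deriv ψ t + G (y, t) * ψ t)) ?_ ?_
  · refine LocallyIntegrable.locallyIntegrableOn ?_ B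
    rw [locallyIntegrable_iff]
    exact fun C hC => (hVint C hC).integral_prod_left
  · intro η hη hηs hηB
    set φ : Y × ℝ → ℝ := fun z => η z.1 * ψ z.2 with hφ
    have hφc : ContDiff ℝ (⊤ : ℕ∞) φ := (hη.comp contDiff_fst).mul (hψ.comp contDiff_snd)
    have hsub : tsupport φ ⊆ tsupport η ×ˢ tsupport ψ := by
      refine closure_minimal (fun z hz => ?_) ((isClosed_tsupport _).prod (isClosed_tsupport _))
      exact ⟨subset_tsupport _ (left_ne_zero_of_mul hz),
        subset_tsupport _ (right_ne_zero_of_mul hz)⟩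
    have hφs : HasCompactSupport φ :=
      (IsCompact.prod hηs hψs).of_isClosed_subset (isClosed_tsupport _) hsub
    have hder : ∀ z : Y × ℝ, fderiv ℝ φ z (0, 1) = η z.1 * deriv ψ z.2 := by
      rintro ⟨y, t⟩
      rw [← deriv_slice (hφc.differentiable (by simp))]
      simp only [hφ]
      exact deriv_const_mul _ (hψ.differentiable (by simp) t)
    have hw := hweak φ hφc hφs (hsub.trans ((Set.prod_mono hηB le_rfl).trans hBψ))
    have hφd : Continuous fun z => fderiv ℝ φ z (0, 1) :=
      (hφc.continuous_fderiv (by simp)).clm_apply continuous_const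
    have i1 : Integrable (fun z => U z * fderiv ℝ φ z (0, 1)) (μ.prod volume) :=
      hU.integrable_smul_right_of_hasCompactSupport hφd (hφs.fderiv_apply ℝ _)
    have i2 : Integrable (fun z => G z * φ z) (μ.prod volume) :=
      hG.integrable_smul_right_of_hasCompactSupport hφc.continuous hφs
    have hsum : ∫ z, (U z * fderiv ℝ φ z (0, 1) + G z * φ z) ∂(μ.prod volume) = 0 := by
      rw [integral_add i1 i2, hw, neg_add_cancel]
    rw [integral_prod (fun z => U z * fderiv ℝ φ z (0, 1) + G z * φ z) (i1.add i2)] at hsum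
    rw [← hsum]
    refine integral_congr_ae (ae_of_all _ fun y => ?_)
    simp only [smul_eq_mul]
    rw [← integral_const_mul]
    refine integral_congr_ae (ae_of_all _ fun t => ?_)
    simp only [hder]
    simp only [hφ]
    ring

/-- If a locally integrable function on `Y × ℝ` is continuous on almost every line `{y} × ℝ` and
has a locally integrable weak derivative in the direction of `ℝ` off a closed set `K` that almost
every such line meets in a countable set, then this is a weak derivative on the whole space. -/
theorem weak_deriv_of_countable_slices {U G : Y × ℝ → ℝ}
    (hU : LocallyIntegrable U (μ.prod volume))
    (hG : LocallyIntegrable G (μ.prod volume)) {K : Set (Y × ℝ)} (hK : IsClosed K)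
    (hcount : ∀ᵐ y ∂μ, {t | (y, t) ∈ K}.Countable)
    (hcont : ∀ᵐ y ∂μ, Continuous fun t => U (y, t))
    (hweak : ∀ φ : Y × ℝ → ℝ, ContDiff ℝ (⊤ : ℕ∞) φ → HasCompactSupport φ → tsupport φ ⊆ Kᶜ →
      ∫ z, U z * fderiv ℝ φ z (0, 1) ∂(μ.prod volume) = -∫ z, G z * φ z ∂(μ.prod volume))
    {φ : Y × ℝ → ℝ} (hφ : ContDiff ℝ (⊤ : ℕ∞) φ) (hφs : HasCompactSupport φ) :
    ∫ z, U z * fderiv ℝ φ z (0, 1) ∂(μ.prod volume) = -∫ z, G z * φ z ∂(μ.prod volume) := by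
  -- The boxes and cutoffs form a countable family, so one null set of `y` serves them all.
  have hall : ∀ᵐ y ∂μ, ∀ B : TopologicalSpace.countableBasis Y, ∀ a b : ℚ, ∀ n : ℕ, a < b →
      (B : Set Y) ×ˢ Set.Icc (a : ℝ) (b + 1 / ((n : ℝ) + 1)) ⊆ Kᶜ → y ∈ (B : Set Y) →
      ∫ t, (U (y, t) * deriv (cutoff a b (1 / ((n : ℝ) + 1))) t +
        G (y, t) * cutoff a b (1 / ((n : ℝ) + 1)) t) = 0 := by
    simp only [ae_all_iff]
    intro B a b n hab hsub
    have hab' : (a : ℝ) ≤ b := by exact_mod_cast hab.le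
    have hr : (0 : ℝ) < 1 / ((n : ℝ) + 1) := by positivity
    exact ae_slice_test hU hG hweak (TopologicalSpace.isOpen_of_mem_countableBasis B.2)
      (contDiff_cutoff _ _ _) (hasCompactSupport_cutoff hab' hr)
      ((Set.prod_mono le_rfl (tsupport_cutoff_subset hab' hr)).trans hsub)
  have hφd : Continuous fun z => fderiv ℝ φ z (0, 1) :=
    (hφ.continuous_fderiv (by simp)).clm_apply continuous_const
  have i1 : Integrable (fun z => U z * fderiv ℝ φ z (0, 1)) (μ.prod volume) :=
    hU.integrable_smul_right_of_hasCompactSupport hφd (hφs.fderiv_apply ℝ _)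
  have i2 : Integrable (fun z => G z * φ z) (μ.prod volume) :=
    hG.integrable_smul_right_of_hasCompactSupport hφ.continuous hφs
  rw [integral_prod _ i1, integral_prod _ i2, ← integral_neg]
  refine integral_congr_ae ?_
  filter_upwards [hall, hcount, hcont, ae_locallyIntegrable_slice hG] with y hy hyK hyU hyG
  have hemb : Continuous fun t : ℝ => (y, t) := by fun_prop
  have hUeq := eq_add_primitive_of_cutoff_test hyU hyG (hK.preimage hemb) hyK (by
    intro a b hab hsub
    -- The tube lemma thickens the segment over `y` to a box off `K`; the spare room `δ` to the
    -- right of `b` absorbs the width of the cutoff.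
    obtain ⟨O, I, hO, hI, hyO, hIab, hOI⟩ := generalized_tube_lemma
      (isCompact_singleton (x := y)) (isCompact_Icc (a := (a : ℝ)) (b := b)) hK.isOpen_compl
      (by rintro ⟨y', t⟩ ⟨rfl, ht⟩; exact hsub ht)
    obtain ⟨B, hB, hyB, hBO⟩ := (TopologicalSpace.isBasis_countableBasis Y).exists_subset_of_mem_open
      (hyO rfl) hO
    have hab' : (a : ℝ) ≤ b := by exact_mod_cast hab.le
    have hIb : I ∈ 𝓝 (b : ℝ) := hI.mem_nhds (hIab ⟨hab', le_rfl⟩)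
    obtain ⟨δ, hδ, hball⟩ := Metric.mem_nhds_iff.1 hIb
    filter_upwards [tendsto_one_div_add_atTop_nhds_zero_nat.eventually (gt_mem_nhds hδ)]
      with n hn
    refine hy ⟨B, hB⟩ a b n hab ?_ hyB
    refine (Set.prod_mono hBO fun t ht => ?_).trans hOI
    rcases le_or_gt t b with h | h
    · exact hIab ⟨ht.1, h⟩
    · apply hball
      rw [Real.ball_eq_Ioo]
      constructor <;> linarith [ht.2])
  have hcs : HasCompactSupport fun t => φ (y, t) :=
    HasCompactSupport.intro (IsCompact.image hφs continuous_snd) fun t ht =>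
      image_eq_zero_of_notMem_tsupport fun h => ht ⟨(y, t), h, rfl⟩
  have hsm : ContDiff ℝ 1 fun t => φ (y, t) :=
    (hφ.of_le (by simp)).comp (contDiff_const.prodMk contDiff_id)
  rw [← integral_const_add_primitive_mul_deriv hyG hsm hcs (U (y, 0))]
  refine integral_congr_ae (ae_of_all _ fun t => ?_)
  simp only
  rw [← hUeq t, deriv_slice (hφ.differentiable (by simp))]

end Product

/-! ### Capacity and projections along lines -/

/-- Average `f a = f s - ∫ f'` over `s` in an interval of length one; the unit length keeps the
constant equal to one. -/
theorem enorm_le_lintegral_add_deriv {f : ℝ → ℝ} (hf : ContDiff ℝ 1 f) (a : ℝ) :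
    ‖f a‖ₑ ≤ ∫⁻ t in Set.Ioc a (a + 1), (‖f t‖ₑ + ‖deriv f t‖ₑ) := by
  have hd : Continuous (deriv f) := hf.continuous_deriv (by simp)
  have hvol : (volume : Measure ℝ) (Set.Ioc a (a + 1)) = 1 := by simp
  have hpt : ∀ s ∈ Set.Ioc a (a + 1),
      ‖f a‖ₑ ≤ ‖f s‖ₑ + ∫⁻ t in Set.Ioc a (a + 1), ‖deriv f t‖ₑ := by
    intro s hs
    have h1 : f a = f s - ∫ t in Set.Ioc a s, deriv f t := by
      rw [← intervalIntegral.integral_of_le hs.1.le, intervalIntegral.integral_deriv_eq_sub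
        (fun x _ => hf.differentiable (by simp) x) (hd.intervalIntegrable _ _)]
      ring
    rw [h1]
    refine enorm_sub_le.trans ?_
    gcongr
    refine (enorm_integral_le_lintegral_enorm _).trans ?_
    exact lintegral_mono_set (Set.Ioc_subset_Ioc_right hs.2)
  calc ‖f a‖ₑ = ∫⁻ _ in Set.Ioc a (a + 1), ‖f a‖ₑ := by simp
    _ ≤ ∫⁻ s in Set.Ioc a (a + 1), (‖f s‖ₑ + ∫⁻ t in Set.Ioc a (a + 1), ‖deriv f t‖ₑ) :=
        setLIntegral_mono' measurableSet_Ioc hpt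
    _ = ∫⁻ t in Set.Ioc a (a + 1), (‖f t‖ₑ + ‖deriv f t‖ₑ) := by
        rw [lintegral_add_right _ measurable_const, lintegral_const,
          Measure.restrict_apply_univ, hvol, mul_one,
          lintegral_add_right _ hd.measurable.enorm]

theorem eLpNorm_fderiv_apply_le {N : ℕ} (p : ℝ≥0∞) (hp : 1 ≤ p)
    {φ : EuclideanSpace ℝ (Fin N) → ℝ} (hφ : ContDiff ℝ (⊤ : ℕ∞) φ)
    (v : EuclideanSpace ℝ (Fin N)) :
    eLpNorm (fun x => fderiv ℝ φ x v) p volume ≤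
      (∑ i, ‖v i‖ₑ) * ∑ i, eLpNorm (partialDeriv i φ) p volume := by
  have hv : (fun x => fderiv ℝ φ x v) = ∑ i, fun x => v i * partialDeriv i φ x := by
    ext x
    conv_lhs => rw [← (EuclideanSpace.basisFun (Fin N) ℝ).sum_repr v]
    simp [partialDeriv]
  have hmeas : ∀ i, AEStronglyMeasurable (fun x => v i * partialDeriv i φ x) volume := fun i =>
    (continuous_const.mul ((hφ.continuous_fderiv (by simp)).clm_apply
      continuous_const)).aestronglyMeasurable
  rw [hv, Finset.sum_mul]
  refine (eLpNorm_sum_le (fun i _ => hmeas i) hp).trans (Finset.sum_le_sum fun i _ => ?_)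
  rw [show (fun x => v i * partialDeriv i φ x) = v i • partialDeriv i φ from rfl,
    eLpNorm_const_smul]
  gcongr
  exact Finset.single_le_sum (f := fun i => eLpNorm (partialDeriv i φ) p volume)
    (fun _ _ => zero_le) (Finset.mem_univ i)

section Capacity

variable {N : ℕ} {Y : Type*} [NormedAddCommGroup Y] [NormedSpace ℝ Y] [FiniteDimensional ℝ Y]
  [MeasurableSpace Y] [BorelSpace Y] {μ : Measure Y} [IsLocallyFiniteMeasure μ] [SFinite μ]

/-- The projection to `Y` of a bounded part of a set has measure controlled by the capacity. -/
theorem exists_measure_projection_le {p : ℝ≥0∞} (hp : 1 ≤ p)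
    (L : (Y × ℝ) ≃L[ℝ] EuclideanSpace ℝ (Fin N))
    (hL : MeasurePreserving L (μ.prod volume) volume) (R : ℝ) :
    ∃ C : ℝ≥0∞, C ≠ ∞ ∧ ∀ (F : Set (EuclideanSpace ℝ (Fin N))) (ε : ℝ≥0∞), capCompact p F < ε →
      μ {y | y ∈ Metric.ball 0 R ∧ ∃ t ∈ Set.Ioo (-R) R, L (y, t) ∈ F} ≤ C * ε := by
  have : ProperSpace Y := FiniteDimensional.proper_real Y
  -- The interval ends at `R + 1` so that it contains the unit interval to the right of every `t <
  -- R`. The measure is finite, so Hölder bounds the `L^1` norm by `M` times the `L^p` norm.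
  set ν : Measure (Y × ℝ) := (μ.restrict (Metric.ball 0 R)).prod
    (volume.restrict (Set.Ioc (-R) (R + 1))) with hν
  have hνle : ν ≤ μ.prod volume := by
    rw [hν, Measure.prod_restrict]; exact Measure.restrict_le_self
  have hνfin : ν Set.univ ≠ ∞ := by
    rw [hν, ← Set.univ_prod_univ, Measure.prod_prod, Measure.restrict_apply_univ,
      Measure.restrict_apply_univ]
    exact ENNReal.mul_ne_top measure_ball_lt_top.ne (by simp)
  set M : ℝ≥0∞ := ν Set.univ ^ (1 / (1 : ℝ≥0∞).toReal - 1 / p.toReal) with hM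
  have hMfin : M ≠ ∞ := by
    refine ENNReal.rpow_ne_top_of_nonneg ?_ hνfin
    rcases eq_or_ne p ∞ with rfl | hpt
    · simp
    · have : 1 ≤ p.toReal := by
        rw [← ENNReal.toReal_one]
        exact (ENNReal.toReal_le_toReal ENNReal.one_ne_top hpt).2 hp
      simp only [ENNReal.toReal_one, div_one, sub_nonneg]
      rw [one_div]; exact inv_le_one_of_one_le₀ this
  set v : EuclideanSpace ℝ (Fin N) := L (0, 1) with hv
  have hone : ∀ f : EuclideanSpace ℝ (Fin N) → ℝ, Continuous f →
      ∫⁻ z, ‖f (L z)‖ₑ ∂ν ≤ eLpNorm f p volume * M := by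
    intro f hf
    have hfL : Continuous (f ∘ L) := hf.comp L.continuous
    calc ∫⁻ z, ‖f (L z)‖ₑ ∂ν = eLpNorm (f ∘ L) 1 ν := by
          rw [eLpNorm_one_eq_lintegral_enorm]; rfl
      _ ≤ eLpNorm (f ∘ L) p ν * M :=
          eLpNorm_le_eLpNorm_mul_rpow_measure_univ hp hfL.aestronglyMeasurable
      _ ≤ eLpNorm (f ∘ L) p (μ.prod volume) * M := by
          gcongr
      _ = eLpNorm f p volume * M := by
          rw [eLpNorm_comp_measurePreserving hf.aestronglyMeasurable hL]
  refine ⟨(1 + ∑ i, ‖v i‖ₑ) * M, ENNReal.mul_ne_top (ENNReal.add_ne_top.2 ⟨ENNReal.one_ne_top,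
    (ENNReal.sum_lt_top.2 fun i _ => enorm_lt_top).ne⟩) hMfin, fun F ε hF => ?_⟩
  obtain ⟨_, ⟨φ, ⟨hφ, hφs, -⟩, hφF, rfl⟩, hφε⟩ := sInf_lt_iff.1 hF
  have hφd : Continuous fun x => fderiv ℝ φ x v :=
    (hφ.continuous_fderiv (by simp)).clm_apply continuous_const
  have hL1 : ContDiff ℝ (⊤ : ℕ∞) fun z => φ (L z) := hφ.comp L.contDiff
  have hder : ∀ y t, deriv (fun s => φ (L (y, s))) t = fderiv ℝ φ (L (y, t)) v := by
    intro y t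
    rw [deriv_slice (φ := fun z => φ (L z)) (hL1.differentiable (by simp))]
    have := ((hφ.differentiable (by simp) (L (y, t))).hasFDerivAt.comp (y, t)
      L.hasFDerivAt).fderiv
    rw [Function.comp_def] at this
    rw [this]; rfl
  -- Over the projection of `F` the line integral `J` is at least one, since `φ ≥ 1` somewhere on
  -- the line; Markov's inequality then bounds the measure of the projection.
  set J : Y → ℝ≥0∞ := fun y => ∫⁻ t in Set.Ioc (-R) (R + 1),
    (‖φ (L (y, t))‖ₑ + ‖fderiv ℝ φ (L (y, t)) v‖ₑ) with hJ
  have hmeasΦ : Measurable fun z : Y × ℝ => ‖φ (L z)‖ₑ + ‖fderiv ℝ φ (L z) v‖ₑ :=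
    (hφ.continuous.comp L.continuous).measurable.enorm.add
      (hφd.comp L.continuous).measurable.enorm
  have hJm : Measurable J := hmeasΦ.lintegral_prod_right'
  have hsub : {y | y ∈ Metric.ball 0 R ∧ ∃ t ∈ Set.Ioo (-R) R, L (y, t) ∈ F} ⊆
      {y | 1 ≤ J y} ∩ Metric.ball 0 R := by
    rintro y ⟨hy, t, ht, htF⟩
    refine ⟨?_, hy⟩
    have h1 := hφF _ htF
    have h2 := enorm_le_lintegral_add_deriv (f := fun s => φ (L (y, s)))
      ((hL1.of_le (by simp)).comp (contDiff_const.prodMk contDiff_id)) t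
    have h3 : (1 : ℝ≥0∞) ≤ ‖φ (L (y, t))‖ₑ := by
      rw [Real.enorm_eq_ofReal_abs, ← ENNReal.ofReal_one]
      exact ENNReal.ofReal_le_ofReal (h1.trans (le_abs_self _))
    refine (h3.trans h2).trans ?_
    simp only [hder]
    exact lintegral_mono_set (Set.Ioc_subset_Ioc ht.1.le (by linarith [ht.2]))
  calc μ {y | y ∈ Metric.ball 0 R ∧ ∃ t ∈ Set.Ioo (-R) R, L (y, t) ∈ F}
      ≤ μ ({y | 1 ≤ J y} ∩ Metric.ball 0 R) := measure_mono hsub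
    _ = μ.restrict (Metric.ball 0 R) {y | 1 ≤ J y} :=
        (Measure.restrict_apply (measurableSet_le measurable_const hJm)).symm
    _ ≤ ∫⁻ y in Metric.ball 0 R, J y ∂μ := by
        simpa using mul_meas_ge_le_lintegral (μ := μ.restrict (Metric.ball 0 R)) hJm 1
    _ = ∫⁻ z, (‖φ (L z)‖ₑ + ‖fderiv ℝ φ (L z) v‖ₑ) ∂ν :=
        (lintegral_prod _ hmeasΦ.aemeasurable).symm
    _ = ∫⁻ z, ‖φ (L z)‖ₑ ∂ν + ∫⁻ z, ‖fderiv ℝ φ (L z) v‖ₑ ∂ν :=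
        lintegral_add_right _ (hφd.comp L.continuous).measurable.enorm
    _ ≤ eLpNorm φ p volume * M + eLpNorm (fun x => fderiv ℝ φ x v) p volume * M :=
        add_le_add (hone _ hφ.continuous) (hone _ hφd)
    _ ≤ eLpNorm φ p volume * M +
        ((∑ i, ‖v i‖ₑ) * ∑ i, eLpNorm (partialDeriv i φ) p volume) * M := by
        gcongr; exact eLpNorm_fderiv_apply_le p hp hφ v
    _ ≤ (1 + ∑ i, ‖v i‖ₑ) * M * sobolevNorm p φ := by
        set A := eLpNorm φ p volume
        set S := ∑ i, eLpNorm (partialDeriv i φ) p volume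
        set s := ∑ i, ‖v i‖ₑ
        have : (1 + s) * M * sobolevNorm p φ = A * M + s * S * M + (s * A * M + S * M) := by
          change (1 + s) * M * (A + S) = _
          ring
        rw [this]
        exact le_self_add
    _ ≤ (1 + ∑ i, ‖v i‖ₑ) * M * ε := by gcongr

/-- Exhaust `ω` by increasing compact sets. The constant does not depend on the set, and continuity
from below along the increasing projections needs no measurability. -/
theorem exists_measure_projection_isOpen_le {p : ℝ≥0∞} (hp : 1 ≤ p)
    (L : (Y × ℝ) ≃L[ℝ] EuclideanSpace ℝ (Fin N))
    (hL : MeasurePreserving L (μ.prod volume) volume) (R : ℝ) :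
    ∃ C : ℝ≥0∞, C ≠ ∞ ∧ ∀ (ω : Set (EuclideanSpace ℝ (Fin N))) (ε : ℝ≥0∞), IsOpen ω →
      capOpen p ω < ε →
      μ {y | y ∈ Metric.ball 0 R ∧ ∃ t ∈ Set.Ioo (-R) R, L (y, t) ∈ ω} ≤ C * ε := by
  obtain ⟨C, hC, h⟩ := exists_measure_projection_le hp L hL R
  refine ⟨C, hC, fun ω ε hω hε => ?_⟩
  obtain ⟨F, hFclosed, hFω, hFU, hFmono⟩ := hω.exists_iUnion_isClosed
  set F' : ℕ → Set (EuclideanSpace ℝ (Fin N)) := fun n => F n ∩ Metric.closedBall 0 n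
  have hF'mono : Monotone F' := fun m n hmn =>
    Set.inter_subset_inter (hFmono hmn) (Metric.closedBall_subset_closedBall (by exact_mod_cast hmn))
  have hset : {y | y ∈ Metric.ball 0 R ∧ ∃ t ∈ Set.Ioo (-R) R, L (y, t) ∈ ω} =
      ⋃ n, {y | y ∈ Metric.ball 0 R ∧ ∃ t ∈ Set.Ioo (-R) R, L (y, t) ∈ F' n} := by
    ext y
    simp only [Set.mem_ofPred_eq, Set.mem_iUnion]
    constructor
    · rintro ⟨hy, t, ht, hω'⟩
      rw [← hFU] at hω'
      obtain ⟨m, hm⟩ := Set.mem_iUnion.1 hω'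
      obtain ⟨k, hk⟩ := exists_nat_ge ‖L (y, t)‖
      refine ⟨max m k, hy, t, ht, hFmono (le_max_left m k) hm, ?_⟩
      rw [mem_closedBall_zero_iff]
      exact hk.trans (by exact_mod_cast le_max_right m k)
    · rintro ⟨n, hy, t, ht, hn⟩
      exact ⟨hy, t, ht, hFω n hn.1⟩
  rw [hset, Monotone.measure_iUnion]
  · refine iSup_le fun n => h _ _ (lt_of_le_of_lt (le_sSup ?_) hε)
    exact ⟨F' n, (isCompact_closedBall _ _).inter_left (hFclosed n),
      Set.inter_subset_left.trans (hFω n), rfl⟩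
  · rintro m n hmn y ⟨hy, t, ht, hm⟩
    exact ⟨hy, t, ht, hF'mono hmn hm⟩

/-- A quasicontinuous function is continuous on almost every line. -/
theorem ae_continuous_slice_of_quasiContinuous {p : ℝ≥0∞} (hp : 1 ≤ p)
    (L : (Y × ℝ) ≃L[ℝ] EuclideanSpace ℝ (Fin N))
    (hL : MeasurePreserving L (μ.prod volume) volume)
    {u : EuclideanSpace ℝ (Fin N) → ℝ} (hu : u ∈ quasiContinuous p) :
    ∀ᵐ y ∂μ, Continuous fun t => u (L (y, t)) := by
  have hex : ∀ n : ℕ, ∃ ω : Set (EuclideanSpace ℝ (Fin N)),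
      IsOpen ω ∧ capOpen p ω < ((n : ℝ≥0∞) + 1)⁻¹ ∧ ContinuousOn u ωᶜ := fun n =>
    hu.2 _ (by simp)
  choose ω hω hcap hcont using hex
  -- The points `y` whose slice of the box of size `R` meets every `ω n` have measure at most `C /
  -- (n + 1)` for all `n`. Almost every other slice thus avoids some `ω n`, and continuity, being
  -- local, may be checked box by box.
  have hR : ∀ R : ℕ, ∀ᵐ y ∂μ, ¬ ∀ n, y ∈ {y | y ∈ Metric.ball (0 : Y) R ∧
      ∃ t ∈ Set.Ioo (-(R : ℝ)) R, L (y, t) ∈ ω n} := by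
    intro R
    obtain ⟨C, hC, h⟩ := exists_measure_projection_isOpen_le hp L hL R
    rw [ae_iff]
    simp only [not_not]
    have hlim : Tendsto (fun n : ℕ => C * ((n : ℝ≥0∞) + 1)⁻¹) atTop (𝓝 0) := by
      have h1 : Tendsto (fun n : ℕ => ((n : ℝ≥0∞) + 1)⁻¹) atTop (𝓝 0) := by
        have := (tendsto_add_atTop_iff_nat 1).2 ENNReal.tendsto_inv_nat_nhds_zero
        simpa using this
      simpa using ENNReal.Tendsto.const_mul h1 (Or.inr hC)
    refine le_antisymm (ge_of_tendsto' hlim fun n => ?_) zero_le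
    refine (measure_mono ?_).trans (h _ _ (hω n) (hcap n))
    exact fun y hy => hy n
  filter_upwards [ae_all_iff.2 hR] with y hy
  rw [continuous_iff_continuousAt]
  intro t
  obtain ⟨R, hRgt⟩ := exists_nat_gt (max ‖y‖ |t|)
  have hyR : y ∈ Metric.ball (0 : Y) R := by
    rw [mem_ball_zero_iff]; exact (le_max_left _ _).trans_lt hRgt
  have htR : t ∈ Set.Ioo (-(R : ℝ)) R := abs_lt.1 ((le_max_right _ _).trans_lt hRgt)
  obtain ⟨n, hn⟩ := not_forall.1 (hy R)
  have hmaps : Set.MapsTo (fun s => L (y, s)) (Set.Ioo (-(R : ℝ)) R) (ω n)ᶜ :=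
    fun s hs hsω => hn ⟨hyR, s, hs, hsω⟩
  exact ((hcont n).comp (by fun_prop) hmaps).continuousAt (Ioo_mem_nhds htR.1 htR.2)

end Capacity

/-! ### Transfer to lines in a given direction -/

variable {N : ℕ}

/-- Linear coordinates `(y, t) ↦ y + t • v` on `v^⊥ × ℝ`, normalized to preserve the volume. -/
theorem exists_line_coordinates {v : EuclideanSpace ℝ (Fin N)} (hv : v ≠ 0) :
    ∃ (c : NNReal) (L : ((Submodule.span ℝ {v})ᗮ × ℝ) ≃L[ℝ] EuclideanSpace ℝ (Fin N)),
      MeasurePreserving L ((c • (volume : Measure (Submodule.span ℝ {v})ᗮ)).prod volume) volume ∧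
      ∀ y t, L (y, t) = y + t • v := by
  let e : ((Submodule.span ℝ {v})ᗮ × ℝ) ≃ₗ[ℝ] EuclideanSpace ℝ (Fin N) :=
    ((LinearEquiv.refl ℝ _).prodCongr (LinearEquiv.toSpanNonzeroSingleton ℝ _ v hv)).trans
      (Submodule.prodEquivOfIsCompl _ _
        (Submodule.isCompl_orthogonal (K := Submodule.span ℝ {v})).symm)
  let L := e.toContinuousLinearEquiv
  set ν : Measure (EuclideanSpace ℝ (Fin N)) :=
    ((volume : Measure (Submodule.span ℝ {v})ᗮ).prod (volume : Measure ℝ)).map L with hν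
  have : ν.IsAddHaarMeasure := L.isAddHaarMeasure_map _
  -- Uniqueness of Haar measure supplies the factor. Its value is immaterial, as only null sets of
  -- lines matter.
  refine ⟨Measure.addHaarScalarFactor volume ν, L, ⟨L.continuous.measurable, ?_⟩, fun y t => ?_⟩
  · have h := Measure.isAddLeftInvariant_eq_smul (volume : Measure (EuclideanSpace ℝ (Fin N))) ν
    rw [Measure.prod_smul_left, Measure.map_smul]
    exact h.symm
  · simp [L, e]

theorem volume_eq_zero_of_countable_slices {Y : Type*} [NormedAddCommGroup Y] [NormedSpace ℝ Y]
    [MeasurableSpace Y] [BorelSpace Y] {μ : Measure Y}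
    (L : (Y × ℝ) ≃L[ℝ] EuclideanSpace ℝ (Fin N))
    (hL : MeasurePreserving L (μ.prod volume) volume) {K : Set (EuclideanSpace ℝ (Fin N))}
    (hK : IsClosed K) (hcount : ∀ᵐ y ∂μ, {t | L (y, t) ∈ K}.Countable) : volume K = 0 := by
  rw [← hL.measure_preimage hK.measurableSet.nullMeasurableSet,
    Measure.measure_prod_null (hK.preimage L.continuous).measurableSet]
  filter_upwards [hcount] with y hy
  exact hy.measure_zero _

theorem fderiv_comp_continuousLinearEquiv {Y : Type*} [NormedAddCommGroup Y] [NormedSpace ℝ Y]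
    (L : (Y × ℝ) ≃L[ℝ] EuclideanSpace ℝ (Fin N))
    {φ : EuclideanSpace ℝ (Fin N) → ℝ} (hφ : Differentiable ℝ φ) (z w : Y × ℝ) :
    fderiv ℝ (φ ∘ L) z w = fderiv ℝ φ (L z) (L w) := by
  rw [((hφ (L z)).hasFDerivAt.comp z L.hasFDerivAt).fderiv]
  rfl

section Transfer

variable {Y : Type*} [NormedAddCommGroup Y] [NormedSpace ℝ Y] [FiniteDimensional ℝ Y]
  [MeasurableSpace Y] [BorelSpace Y] {μ : Measure Y} [SFinite μ]

theorem weak_directional_deriv_of_countable_slices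
    (L : (Y × ℝ) ≃L[ℝ] EuclideanSpace ℝ (Fin N))
    (hL : MeasurePreserving L (μ.prod volume) volume) {K : Set (EuclideanSpace ℝ (Fin N))}
    (hK : IsClosed K) (hcount : ∀ᵐ y ∂μ, {t | L (y, t) ∈ K}.Countable)
    {u g : EuclideanSpace ℝ (Fin N) → ℝ} (hu : LocallyIntegrable u) (hg : LocallyIntegrable g)
    (hcont : ∀ᵐ y ∂μ, Continuous fun t => u (L (y, t)))
    (hweak : ∀ φ, IsTestFunction Kᶜ φ →
      ∫ x, u x * fderiv ℝ φ x (L (0, 1)) = -∫ x, g x * φ x)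
    {φ : EuclideanSpace ℝ (Fin N) → ℝ} (hφ : ContDiff ℝ (⊤ : ℕ∞) φ) (hφs : HasCompactSupport φ) :
    ∫ x, u x * fderiv ℝ φ x (L (0, 1)) = -∫ x, g x * φ x := by
  have hloc : ∀ {f : EuclideanSpace ℝ (Fin N) → ℝ}, LocallyIntegrable f →
      LocallyIntegrable (f ∘ L) (μ.prod volume) := by
    intro f hf
    rw [← hL.map_eq] at hf
    exact (locallyIntegrable_map_homeomorph L.toHomeomorph).1 hf
  have hint : ∀ f : EuclideanSpace ℝ (Fin N) → ℝ,
      ∫ z, f (L z) ∂(μ.prod volume) = ∫ x, f x := fun f =>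
    hL.integral_comp L.toHomeomorph.measurableEmbedding f
  have hpull : ∀ φ : EuclideanSpace ℝ (Fin N) → ℝ, ContDiff ℝ (⊤ : ℕ∞) φ →
      ((∫ z, (u ∘ L) z * fderiv ℝ (φ ∘ L) z (0, 1) ∂(μ.prod volume) =
        -∫ z, (g ∘ L) z * (φ ∘ L) z ∂(μ.prod volume)) ↔
      (∫ x, u x * fderiv ℝ φ x (L (0, 1)) = -∫ x, g x * φ x)) := by
    intro φ hφ
    rw [← hint, ← hint]
    simp only [fderiv_comp_continuousLinearEquiv L (hφ.differentiable (by simp)),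
      Function.comp_apply]
  refine (hpull φ hφ).1 (weak_deriv_of_countable_slices (hloc hu) (hloc hg)
    (hK.preimage L.continuous) hcount hcont ?_ (hφ.comp L.contDiff)
    (hφs.comp_homeomorph L.toHomeomorph))
  intro ψ hψ hψs hψK
  have hψc : ContDiff ℝ (⊤ : ℕ∞) (ψ ∘ L.symm) := hψ.comp L.symm.contDiff
  have htest : IsTestFunction Kᶜ (ψ ∘ L.symm) := by
    refine ⟨hψc, hψs.comp_homeomorph L.symm.toHomeomorph, ?_⟩
    intro x hx
    have h1 : L.symm x ∈ tsupport ψ := tsupport_comp_subset_preimage ψ L.symm.continuous hx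
    have h2 := hψK h1
    simpa using h2
  have := (hpull _ hψc).2 (hweak _ htest)
  have hcomp : (ψ ∘ L.symm) ∘ L = ψ := by ext z; simp
  rwa [hcomp] at this

end Transfer

/-! ### From the given directions to the coordinate directions -/

/-- Distributional gradients: pairing a locally integrable function with the derivative of a test
function gives a linear functional of the direction. -/
theorem integral_mul_fderiv_apply {u φ : EuclideanSpace ℝ (Fin N) → ℝ} (hu : LocallyIntegrable u)
    (hφ : ContDiff ℝ (⊤ : ℕ∞) φ) (hφs : HasCompactSupport φ) (v : EuclideanSpace ℝ (Fin N)) :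
    ∫ x, u x * fderiv ℝ φ x v = (∫ x, u x • fderiv ℝ φ x) v := by
  rw [ContinuousLinearMap.integral_apply]
  · rfl
  · exact hu.integrable_smul_right_of_hasCompactSupport (hφ.continuous_fderiv (by simp))
      (hφs.fderiv ℝ)

theorem integral_sum_smul_mul {g : Fin N → EuclideanSpace ℝ (Fin N) → ℝ}
    {φ : EuclideanSpace ℝ (Fin N) → ℝ} (hg : ∀ i, LocallyIntegrable (g i))
    (hφ : Continuous φ) (hφs : HasCompactSupport φ) (v : EuclideanSpace ℝ (Fin N)) :
    ∫ x, (∑ i, v i * g i x) * φ x = (∑ i, (∫ x, g i x * φ x) •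
      (EuclideanSpace.proj i : EuclideanSpace ℝ (Fin N) →L[ℝ] ℝ)) v := by
  simp only [Finset.sum_mul, mul_assoc]
  rw [integral_finsetSum]
  · simp only [integral_const_mul]
    simp [mul_comm]
  · intro i _
    exact ((hg i).integrable_smul_right_of_hasCompactSupport hφ hφs).const_mul _

/-- Two continuous linear functionals agree if they agree on `N` linearly independent vectors. -/
theorem clm_ext_of_linearIndependent {v : Fin N → EuclideanSpace ℝ (Fin N)}
    (hv : LinearIndependent ℝ v) {A B : EuclideanSpace ℝ (Fin N) →L[ℝ] ℝ}
    (h : ∀ i, A (v i) = B (v i)) : A = B := by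
  have hspan : Submodule.span ℝ (Set.range v) = ⊤ :=
    hv.span_eq_top_of_card_eq_finrank' (by simp)
  refine ContinuousLinearMap.coe_injective (LinearMap.ext_on_range hspan h)

/-- If `u` is continuous on almost all lines in each of `N` linearly independent directions, and
almost all these lines meet `K` in a countable set, then `u` is in `W^{1,p}` if it is so off `K`. -/
theorem mem_W1p_univ_of_countable_slices {p : ℝ≥0∞} (hp : 1 ≤ p)
    {K : Set (EuclideanSpace ℝ (Fin N))} (hK : IsClosed K) (hK0 : volume K = 0)
    {v : Fin N → EuclideanSpace ℝ (Fin N)} (hv : LinearIndependent ℝ v)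
    {c : Fin N → NNReal}
    (L : ∀ i, ((Submodule.span ℝ {v i})ᗮ × ℝ) ≃L[ℝ] EuclideanSpace ℝ (Fin N))
    (hL : ∀ i, MeasurePreserving (L i)
      ((c i • (volume : Measure (Submodule.span ℝ {v i})ᗮ)).prod volume) volume)
    (hLv : ∀ i, L i (0, 1) = v i)
    (hcount : ∀ i, ∀ᵐ y ∂(c i • (volume : Measure (Submodule.span ℝ {v i})ᗮ)),
      {t | L i (y, t) ∈ K}.Countable)
    {u : EuclideanSpace ℝ (Fin N) → ℝ}
    (hcont : ∀ i, ∀ᵐ y ∂(c i • (volume : Measure (Submodule.span ℝ {v i})ᗮ)),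
      Continuous fun t => u (L i (y, t)))
    (hu : u ∈ W1p p Kᶜ) : u ∈ W1p p Set.univ := by
  have hres : volume.restrict Kᶜ = (volume : Measure (EuclideanSpace ℝ (Fin N))) :=
    Measure.restrict_eq_self_of_ae_mem (by rwa [ae_iff, show {a | a ∉ Kᶜ} = K by ext; simp])
  obtain ⟨hup, hud⟩ := hu
  choose g hgp hg using hud
  simp only [hres, IsWeakPartialDeriv] at hup hgp hg
  have hul : LocallyIntegrable u := hup.locallyIntegrable hp
  have hgl : ∀ i, LocallyIntegrable (g i) := fun i => (hgp i).locallyIntegrable hp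
  refine ⟨by rwa [Measure.restrict_univ], fun i => ⟨g i, by rw [Measure.restrict_univ]; exact hgp i,
    fun φ hφ => ?_⟩⟩
  rw [Measure.restrict_univ]
  -- Linearity in the direction is used twice: from the standard basis to the `v j` for test
  -- functions off `K`, and from the `v j` back to the standard basis for arbitrary test functions.
  have key : ∀ {φ : EuclideanSpace ℝ (Fin N) → ℝ} {w : Fin N → EuclideanSpace ℝ (Fin N)},
      LinearIndependent ℝ w → ContDiff ℝ (⊤ : ℕ∞) φ → HasCompactSupport φ →
      (∀ j, ∫ x, u x * fderiv ℝ φ x (w j) = -∫ x, (∑ i, w j i * g i x) * φ x) →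
      ∀ v, ∫ x, u x * fderiv ℝ φ x v = -∫ x, (∑ i, v i * g i x) * φ x := by
    intro φ w hw hφ hφs h v
    simp only [integral_mul_fderiv_apply hul hφ hφs,
      integral_sum_smul_mul hgl hφ.continuous hφs] at h ⊢
    rw [clm_ext_of_linearIndependent hw (B := -(∑ i, (∫ x, g i x * φ x) •
      (EuclideanSpace.proj i : EuclideanSpace ℝ (Fin N) →L[ℝ] ℝ))) h]
    rfl
  have hsingle : ∀ (j : Fin N) (x : EuclideanSpace ℝ (Fin N)),
      ∑ i, (EuclideanSpace.single j (1 : ℝ)) i * g i x = g j x := by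
    intro j x
    simp
  have hbasis : LinearIndependent ℝ fun j : Fin N => EuclideanSpace.single j (1 : ℝ) := by
    have := (EuclideanSpace.basisFun (Fin N) ℝ).toBasis.linearIndependent
    rwa [OrthonormalBasis.coe_toBasis, show ⇑(EuclideanSpace.basisFun (Fin N) ℝ) =
      fun j => EuclideanSpace.single j (1 : ℝ) from funext fun j => by simp] at this
  have hdir : ∀ j, ∫ x, u x * fderiv ℝ φ x (v j) = -∫ x, (∑ i, v j i * g i x) * φ x := by
    intro j
    have := weak_directional_deriv_of_countable_slices (L j) (hL j) hK (hcount j) hul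
      (g := fun x => ∑ i, v j i * g i x)
      (locallyIntegrable_finsetSum _ fun i _ => (hgl i).smul (v j i)) (hcont j)
      (fun ψ hψ => by
        rw [hLv]
        refine key hbasis hψ.1 hψ.2.1 (fun k => ?_) (v j)
        simp only [hsingle]
        exact hg k ψ hψ) hφ.1 hφ.2.1
    rwa [hLv] at this
  have := key hv hφ.1 hφ.2.1 hdir (EuclideanSpace.single i 1)
  simp only [hsingle] at this
  exact this

theorem W1p_univ_subset {p : ℝ≥0∞} {K : Set (EuclideanSpace ℝ (Fin N))} (hK0 : volume K = 0) :
    W1p p Set.univ ⊆ W1p p Kᶜ := by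
  have hres : volume.restrict Kᶜ = (volume : Measure (EuclideanSpace ℝ (Fin N))) :=
    Measure.restrict_eq_self_of_ae_mem (by rwa [ae_iff, show {a | a ∉ Kᶜ} = K by ext; simp])
  rintro u ⟨hup, hud⟩
  simp only [Measure.restrict_univ, IsWeakPartialDeriv] at hup hud
  refine ⟨by rwa [hres], fun i => ?_⟩
  obtain ⟨g, hg, h⟩ := hud i
  exact ⟨g, by rwa [hres], fun φ hφ => by
    rw [hres]; exact h φ ⟨hφ.1, hφ.2.1, Set.subset_univ _⟩⟩

end SobolevRemovability

theorem corollary1p9 (N : ℕ) (hN : 1 ≤ N) (p : ℝ≥0∞) (hp : 1 ≤ p) (hp_top : p ≠ ∞)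
    (K : Set (EuclideanSpace ℝ (Fin N))) (hK : IsCompact K)
    (v : Fin N → EuclideanSpace ℝ (Fin N)) (hv : LinearIndependent ℝ v)
    (hlines : ∀ i : Fin N, SobolevRemovability.AELineMeetsCountably K (v i)) :
    SobolevRemovability.JProperty p K ∧ SobolevRemovability.JPropertyCont p K := by
  choose c L hL hLyt using fun i => SobolevRemovability.exists_line_coordinates (hv.ne_zero i)
  have hcount : ∀ i, ∀ᵐ y ∂(c i • (volume : Measure (Submodule.span ℝ {v i})ᗮ)),
      {t | L i (y, t) ∈ K}.Countable := by
    intro i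
    refine Measure.ae_smul_measure ?_ (c i)
    filter_upwards [hlines i] with y hy
    have hinj : Function.Injective fun t : ℝ => L i (y, t) := fun s t hst =>
      (Prod.ext_iff.1 ((L i).injective hst)).2
    refine (hy.preimage hinj).mono fun t ht => ?_
    exact ⟨ht, t, hLyt i y t⟩
  -- One direction suffices here, and `hN` provides it.
  have hK0 : volume K = 0 :=
    SobolevRemovability.volume_eq_zero_of_countable_slices (L ⟨0, hN⟩) (hL ⟨0, hN⟩) hK.isClosed
      (hcount ⟨0, hN⟩)
  have hLv : ∀ i, L i (0, 1) = v i := fun i => by rw [hLyt]; simp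
  have hmain := fun u => SobolevRemovability.mem_W1p_univ_of_countable_slices (u := u) hp
    hK.isClosed hK0 hv L hL hLv hcount
  refine ⟨?_, ?_⟩
  · refine Set.Subset.antisymm (fun u hu => ⟨hu.1, hmain u (fun i => ?_) hu.2⟩)
      (Set.inter_subset_inter_right _ (SobolevRemovability.W1p_univ_subset hK0))
    exact SobolevRemovability.ae_continuous_slice_of_quasiContinuous hp (L i) (hL i) hu.1
  · refine Set.Subset.antisymm (fun u hu => ⟨hu.1, hmain u (fun i => ?_) hu.2⟩)
      (Set.inter_subset_inter_right _ (SobolevRemovability.W1p_univ_subset hK0))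
    have huc : Continuous u := hu.1
    exact ae_of_all _ fun y => huc.comp ((L i).continuous.comp (by fun_prop))
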